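/- Let $(X,d)$ be a compact metric space and let $f:X\to X$ be a continuous map with the limit shadowing property (for every sequence $(x_i)_{i\ge0}$ in $X$ with $\lim_{i\to\infty}d(f(x_i),x_{i+1})=0$ there is $x\in X$ with $\lim_{i\to\infty}d(f^i(x),x_i)=0$) and with positive topological entropy $h_{top}(f)>0$. A pair $(x,y)\in X^2$ is called a DC1-pair for $f$ if $$\limsup_{n\to\infty}\tfrac1n\,|\{0\le i\le n-1: d(f^i(x),f^i(y))<\delta\}|=1\quad\text{for every }\delta>0$$ and $$\limsup_{n\to\infty}\tfrac1n\,|\{0\le i\le n-1: d(f^i(x),f^i(y))>\delta_0\}|=1\quad\text{for some }\delta_0>0.$$ A pair $(x,y)\in X^2$ with $x\ne y$ is called an entropy pair for $f$ if $h(f,\{A^c,B^c\})>0$ for all disjoint closed neighborhoods $A$ of $x$ and $B$ of $y$. Here, for an open cover $\mathcal U$ of $X$, $h(f,\mathcal U)=\lim_{n\to\infty}\frac1n\log N(\mathcal U\vee f^{-1}\mathcal U\vee\cdots\vee f^{-(n-1)}\mathcal U)$, where $N(\mathcal V)$ is the least cardinality of a subcover of $\mathcal V$. Then $f$ exhibits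 distributional chaos of type 1 (DC1): there is an uncountable set $S\subset X$ such that $(x,y)$ is a DC1-pair for $f$ for all $x,y\in S$ with $x\ne y$. Moreover, $E(X,f)\subset\overline{DC1(X,f)}$, where $E(X,f)$ is the set of entropy pairs for $f$, $DC1(X,f)$ is the set of DC1-pairs for $f$, and the closure is taken in $X\times X$. -/

import Mathlib

open Filter Topology

noncomputable section

namespace LimitShadowingDC1

/-- `(x i)` is a limit pseudo orbit of `f`: `d(f(x i), x (i+1)) → 0`. -/
def IsLimitPseudoOrbit {X : Type*} [MetricSpace X] (f : X → X) (x : ℕ → X) : Prop :=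
  Tendsto (fun i : ℕ => dist (f (x i)) (x (i + 1))) atTop (𝓝 0)

/-- The limit shadowing property: each limit pseudo orbit `(x i)` has a limit shadowing point `p`,
that is `d(f^i(p), x i) → 0`. -/
def HasLimitShadowing {X : Type*} [MetricSpace X] (f : X → X) : Prop :=
  ∀ x : ℕ → X, IsLimitPseudoOrbit f x →
    ∃ p : X, Tendsto (fun i : ℕ => dist (f^[i] p) (x i)) atTop (𝓝 0)

/-- `(x, y)` is a DC1-pair for `f`. -/
def IsDC1Pair {X : Type*} [MetricSpace X] (f : X → X) (x y : X) : Prop :=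
  (∀ δ : ℝ, 0 < δ →
    limsup (fun n : ℕ =>
      (Set.ncard {i : ℕ | i < n ∧ dist (f^[i] x) (f^[i] y) < δ} : ℝ) / (n : ℝ)) atTop = 1) ∧
  (∃ δ₀ : ℝ, 0 < δ₀ ∧
    limsup (fun n : ℕ =>
      (Set.ncard {i : ℕ | i < n ∧ δ₀ < dist (f^[i] x) (f^[i] y)} : ℝ) / (n : ℝ)) atTop = 1)

/-- The set of DC1-pairs for `f`. -/
def DC1Pairs {X : Type*} [MetricSpace X] (f : X → X) : Set (X × X) :=
  {p | IsDC1Pair f p.1 p.2}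

/-- `f` exhibits distributional chaos of type 1. -/
def ExhibitsDC1 {X : Type*} [MetricSpace X] (f : X → X) : Prop :=
  ∃ S : Set X, ¬ S.Countable ∧ ∀ x ∈ S, ∀ y ∈ S, x ≠ y → IsDC1Pair f x y

/-- The join `𝒰 ∨ f⁻¹ 𝒰 ∨ ⋯ ∨ f^{-(n-1)} 𝒰`: all sets `⋂_{i < n} f^{-i}(U i)` with `U i ∈ 𝒰`. -/
def iteratedJoin {X : Type*} (f : X → X) (𝒰 : Set (Set X)) (n : ℕ) : Set (Set X) :=
  {W | ∃ U : Fin n → Set X, (∀ i, U i ∈ 𝒰) ∧ W = ⋂ i : Fin n, f^[(i : ℕ)] ⁻¹' U i}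

/-- The least cardinality of a subfamily of `𝒱` that covers `X` (`⊤` if there is no finite one). -/
def minSubcoverCard {X : Type*} (𝒱 : Set (Set X)) : ℕ∞ :=
  ⨅ (𝒲 : Set (Set X)) (_ : 𝒲 ⊆ 𝒱 ∧ ⋃₀ 𝒲 = Set.univ), 𝒲.encard

/-- The entropy `h(f, 𝒰)` of `f` relative to the open cover `𝒰`: the exponential growth rate
`lim (1/n) log N(𝒰 ∨ f⁻¹ 𝒰 ∨ ⋯ ∨ f^{-(n-1)} 𝒰)`. The limit exists by subadditivity, so it is
the `limsup` used here. -/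
def entropyRelCover {X : Type*} (f : X → X) (𝒰 : Set (Set X)) : EReal :=
  ExpGrowth.expGrowthSup fun n : ℕ => (minSubcoverCard (iteratedJoin f 𝒰 n) : ENNReal)

/-- `(x, y)` is an entropy pair for `f`. -/
def IsEntropyPair {X : Type*} [MetricSpace X] (f : X → X) (x y : X) : Prop :=
  x ≠ y ∧ ∀ A B : Set X, IsClosed A → A ∈ 𝓝 x → IsClosed B → B ∈ 𝓝 y → A ∩ B = ∅ →
    0 < entropyRelCover f {Aᶜ, Bᶜ}

/-- The set of entropy pairs for `f`. -/
def entropyPairs {X : Type*} [MetricSpace X] (f : X → X) : Set (X × X) :=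
  {p | IsEntropyPair f p.1 p.2}

/-- The topological entropy of `f`, in the Bowen-Dinaburg form. -/
def topEntropy {X : Type*} [MetricSpace X] (f : X → X) : EReal :=
  Dynamics.coverEntropy f Set.univ

end LimitShadowingDC1

end

noncomputable section

namespace LimitShadowingDC1

variable {X : Type*} [MetricSpace X]

/-! The bridge between entropy and chaos is the relation `ChainPair`: at every scale, chains of one
common length join any two of the two points.

Entropy forces this relation. If `x` and `y` are not linked at scale `δ`, then either visits near
one point can never be followed by visits near the other, or both kinds of transition occur but the
visit times are separated by their residues modulo the chain period. In each case linearly many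
binary words describe how orbit segments of length `n` avoid small neighbourhoods of `x` or `y`
(`exists_separating_words`). Hence an entropy pair is a chain pair, and if all chain pairs were
diagonal, compactness would make orbit complexity polynomial, contradicting positive entropy.

Conversely, limit shadowing turns chain pairs into chaos. It gives shadowing of closed chains, hence
orbits that follow arbitrary words in `x` and `y` at multiples of some `n`. A word with ever longer
constant blocks yields, in an omega-limit set, chain pairs that stay near `(x, y)` under the `n`-th
iterate, and a minimal set of such pairs supplies a recurrent distal chain pair `(z, w)` near `(x,
y)`. Recurrence closes up long stretches of the orbits of `z` and `w` with vanishing error, and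
chains of common length switch between them on a schedule independent of the choices. Limit
shadowing then realizes every choice sequence: agreement gives proximity and disagreement gives
separation, each with upper density one. -/

/-- There is a `δ`-chain of `f` of length `n` from `a` to `b`. -/
def HasChain (f : X → X) (δ : ℝ) (n : ℕ) (a b : X) : Prop :=
  ∃ c : ℕ → X, c 0 = a ∧ c n = b ∧ ∀ i < n, dist (f (c i)) (c (i + 1)) < δ

/-- There are `δ`-chains of the common length `n` between any two of the points `x`, `y`. -/
def ChainLinked (f : X → X) (δ : ℝ) (n : ℕ) (x y : X) : Prop :=
  HasChain f δ n x x ∧ HasChain f δ n x y ∧ HasChain f δ n y x ∧ HasChain f δ n y y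

/-- The points `x` and `y` are linked by chains of a common length at every scale. -/
def ChainPair (f : X → X) (x y : X) : Prop :=
  ∀ δ : ℝ, 0 < δ → ∃ n : ℕ, 0 < n ∧ ChainLinked f δ n x y

/-! ### Operations on chains and closedness of the chain-pair relation. -/

variable {f : X → X} {δ : ℝ}

theorem HasChain.trans {m n : ℕ} {a b c : X} (h : HasChain f δ m a b) (h' : HasChain f δ n b c) :
    HasChain f δ (m + n) a c := by
  obtain ⟨u, u0, um, hu⟩ := h
  obtain ⟨v, v0, vn, hv⟩ := h'
  refine ⟨fun i => if i < m then u i else v (i - m), ?_, ?_, ?_⟩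
  · by_cases hm : 0 < m
    · simp [hm, u0]
    · obtain rfl : m = 0 := by omega
      simp [v0, ← um, u0]
  · simp [vn]
  · intro i hi
    by_cases h1 : i + 1 < m
    · simpa [h1, show i < m by omega] using hu i (by omega)
    · by_cases h2 : i < m
      · obtain rfl : m = i + 1 := by omega
        simpa [v0, um] using hu i (by omega)
      · have := hv (i - m) (by omega)
        simpa [h1, h2, show i + 1 - m = i - m + 1 by omega] using this

theorem HasChain.refl (f : X → X) (δ : ℝ) (a : X) : HasChain f δ 0 a a :=
  ⟨fun _ => a, rfl, rfl, by simp⟩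

theorem hasChain_iterate (f : X → X) (hδ : 0 < δ) (n : ℕ) (a : X) :
    HasChain f δ n a (f^[n] a) :=
  ⟨fun i => f^[i] a, rfl, rfl, fun i _ => by
    simpa [Function.iterate_succ_apply'] using hδ⟩

/-- Only the image of the initial point enters the error, so closeness of `f a'` to `f a` suffices
there. A chain of length one pays for both ends in the same step, whence `2 * η`. -/
theorem HasChain.perturb {n : ℕ} {a b a' b' : X} {η : ℝ} (h : HasChain f δ n a b) (hn : 0 < n)
    (ha : dist (f a') (f a) ≤ η) (hb : dist b b' ≤ η) : HasChain f (δ + 2 * η) n a' b' := by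
  obtain ⟨c, rfl, rfl, hc⟩ := h
  have hη : 0 ≤ η := dist_nonneg.trans hb
  refine ⟨fun i => if i = 0 then a' else if i = n then b' else c i, by simp, by simp [hn.ne'], ?_⟩
  intro i hi
  have h1 : dist (f (if i = 0 then a' else if i = n then b' else c i)) (f (c i)) ≤ η := by
    by_cases h0 : i = 0
    · simpa [h0] using ha
    · simp [h0, hi.ne, hη]
  have h2 : dist (c (i + 1)) (if i + 1 = 0 then a' else if i + 1 = n then b' else c (i + 1)) ≤ η := by
    by_cases h0 : i + 1 = n
    · simpa [h0, hn.ne'] using hb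
    · simp [h0, hη]
  have h3 := hc i hi
  have h4 := dist_triangle4 (f (if i = 0 then a' else if i = n then b' else c i)) (f (c i))
    (c (i + 1)) (if i + 1 = 0 then a' else if i + 1 = n then b' else c (i + 1))
  linarith

theorem HasChain.map {n : ℕ} {a b : X} {δ' : ℝ} (h : HasChain f δ' n a b)
    (hδ : ∀ u v, dist u v < δ' → dist (f u) (f v) < δ) : HasChain f δ n (f a) (f b) := by
  obtain ⟨c, rfl, rfl, hc⟩ := h
  exact ⟨fun i => f (c i), rfl, rfl, fun i hi => hδ _ _ (hc i hi)⟩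

theorem HasChain.mono {n : ℕ} {a b : X} {δ' : ℝ} (h : HasChain f δ' n a b) (hδ : δ' ≤ δ) :
    HasChain f δ n a b := by
  obtain ⟨c, h0, hn, hc⟩ := h
  exact ⟨c, h0, hn, fun i hi => (hc i hi).trans_le hδ⟩

theorem ChainLinked.mono {n : ℕ} {a b : X} {δ' : ℝ} (h : ChainLinked f δ' n a b) (hδ : δ' ≤ δ) :
    ChainLinked f δ n a b :=
  ⟨h.1.mono hδ, h.2.1.mono hδ, h.2.2.1.mono hδ, h.2.2.2.mono hδ⟩

theorem ChainLinked.perturb {n : ℕ} {a b a' b' : X} {η : ℝ} (h : ChainLinked f δ n a b)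
    (hn : 0 < n) (ha : dist a a' ≤ η) (hb : dist b b' ≤ η) (hfa : dist (f a') (f a) ≤ η)
    (hfb : dist (f b') (f b) ≤ η) : ChainLinked f (δ + 2 * η) n a' b' :=
  ⟨h.1.perturb hn hfa ha, h.2.1.perturb hn hfa hb, h.2.2.1.perturb hn hfb ha,
    h.2.2.2.perturb hn hfb hb⟩

theorem ChainPair.of_tendsto (hf : Continuous f) {a b : ℕ → X} {x y : X}
    (ha : Tendsto a atTop (𝓝 x)) (hb : Tendsto b atTop (𝓝 y))
    (h : ∀ δ : ℝ, 0 < δ → ∀ᶠ k in atTop, ∃ n : ℕ, 0 < n ∧ ChainLinked f δ n (a k) (b k)) :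
    ChainPair f x y := by
  intro δ hδ
  have h3 : (0 : ℝ) < δ / 3 := by positivity
  have e1 := Metric.tendsto_nhds.1 ha _ h3
  have e2 := Metric.tendsto_nhds.1 hb _ h3
  have e3 := Metric.tendsto_nhds.1 ((hf.tendsto x).comp ha) _ h3
  have e4 := Metric.tendsto_nhds.1 ((hf.tendsto y).comp hb) _ h3
  obtain ⟨k, ⟨n, hn, hl⟩, h1, h2, h3, h4⟩ := ((h _ h3).and (e1.and (e2.and (e3.and e4)))).exists
  refine ⟨n, hn, (hl.perturb hn h1.le h2.le ?_ ?_).mono (δ := δ) (by linarith)⟩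
  · rw [dist_comm]; exact h3.le
  · rw [dist_comm]; exact h4.le

/-- Linked pairs at all scales in a compact set accumulate at a pair linked at every scale. -/
theorem exists_chainPair_of_isCompact (hf : Continuous f) {K : Set (X × X)} (hK : IsCompact K)
    (h : ∀ δ : ℝ, 0 < δ → ∃ p ∈ K, ∃ n : ℕ, 0 < n ∧ ChainLinked f δ n p.1 p.2) :
    ∃ p ∈ K, ChainPair f p.1 p.2 := by
  have h' : ∀ k : ℕ, ∃ p ∈ K, ∃ n : ℕ, 0 < n ∧ ChainLinked f (1 / ((k : ℝ) + 1)) n p.1 p.2 :=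
    fun k => h _ (by positivity)
  choose p hpK hp using h'
  obtain ⟨q, hqK, φ, hφ, hlim⟩ := hK.tendsto_subseq hpK
  refine ⟨q, hqK, ChainPair.of_tendsto hf (a := fun k => (p (φ k)).1) (b := fun k => (p (φ k)).2)
    ((continuous_fst.tendsto q).comp hlim) ((continuous_snd.tendsto q).comp hlim) ?_⟩
  intro δ hδ
  have := (tendsto_one_div_add_atTop_nhds_zero_nat (𝕜 := ℝ)).comp hφ.tendsto_atTop
  filter_upwards [this.eventually_lt_const hδ] with k hk
  obtain ⟨n, hn, hl⟩ := hp (φ k)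
  exact ⟨n, hn, hl.mono hk.le⟩

theorem isClosed_setOf_chainPair (hf : Continuous f) :
    IsClosed {p : X × X | ChainPair f p.1 p.2} := by
  refine isClosed_of_closure_subset fun q hq => ?_
  obtain ⟨p, hp, hlim⟩ := mem_closure_iff_seq_limit.1 hq
  exact ChainPair.of_tendsto hf ((continuous_fst.tendsto q).comp hlim)
    ((continuous_snd.tendsto q).comp hlim) fun δ hδ => Eventually.of_forall fun k => hp k δ hδ

theorem ChainPair.map [CompactSpace X] (hf : Continuous f) {x y : X} (h : ChainPair f x y) :
    ChainPair f (f x) (f y) := by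
  intro δ hδ
  obtain ⟨δ', hδ', hm⟩ := Metric.uniformContinuous_iff.1
    (CompactSpace.uniformContinuous_of_continuous hf) δ hδ
  obtain ⟨n, hn, h1, h2, h3, h4⟩ := h δ' hδ'
  have hm' : ∀ u v, dist u v < δ' → dist (f u) (f v) < δ := fun _ _ h => hm h
  exact ⟨n, hn, h1.map hm', h2.map hm', h3.map hm', h4.map hm'⟩

theorem ChainPair.iterate [CompactSpace X] (hf : Continuous f) {x y : X} (h : ChainPair f x y)
    (n : ℕ) : ChainPair f (f^[n] x) (f^[n] y) := by
  induction n with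
  | zero => exact h
  | succ n ih => simpa only [Function.iterate_succ_apply'] using ih.map hf

/-! ### Chain periods. -/

/-- The greatest common divisor of the lengths of the `δ`-chains from `x` to itself. -/
def chainPeriod (f : X → X) (δ : ℝ) (x : X) : ℕ :=
  Nat.setGcd {n | HasChain f δ n x x}

theorem chainPeriod_dvd {n : ℕ} {x : X} (h : HasChain f δ n x x) : chainPeriod f δ x ∣ n :=
  Nat.setGcd_dvd_of_mem h

/-- Loop lengths at `x` form an additive submonoid of `ℕ`, which contains all large multiples of its
gcd. -/
theorem exists_hasChain_of_chainPeriod_dvd (f : X → X) (δ : ℝ) (x : X) :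
    ∃ N, ∀ n ≥ N, chainPeriod f δ x ∣ n → HasChain f δ n x x := by
  obtain ⟨N, hN⟩ := Nat.exists_mem_closure_of_ge {n | HasChain f δ n x x}
  refine ⟨N, fun n hn hd => ?_⟩
  let S : AddSubmonoid ℕ :=
    { carrier := {n | HasChain f δ n x x}
      zero_mem' := HasChain.refl f δ x
      add_mem' := fun ha hb => HasChain.trans ha hb }
  have hS : AddSubmonoid.closure {n | HasChain f δ n x x} ≤ S :=
    AddSubmonoid.closure_le.2 fun _ h => h
  exact hS (hN n hn hd)

/-- Every loop length is a multiple of the period `m`, so `m` divides the return length `t` as well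
as `r`. Loops at `x` of suitable large multiples of `m` then pad all four connections to the same
length. -/
theorem exists_chainLinked_of_dvd {x y : X} {r t : ℕ} (hr : HasChain f δ r x y)
    (ht : HasChain f δ t y x) (hpos : 0 < r + t) (hd : chainPeriod f δ x ∣ r) :
    ∃ n : ℕ, 0 < n ∧ ChainLinked f δ n x y := by
  obtain ⟨N, hN⟩ := exists_hasChain_of_chainPeriod_dvd f δ x
  set m := chainPeriod f δ x with hm
  have hrt : m ∣ r + t := chainPeriod_dvd (hr.trans ht)
  have hdt : m ∣ t := (Nat.dvd_add_right hd).1 hrt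
  have hm0 : 0 < m := Nat.pos_of_dvd_of_pos hrt hpos
  have hK : N + r + t + 1 ≤ m * (N + r + t + 1) := Nat.le_mul_of_pos_left _ hm0
  have hmK : m ∣ m * (N + r + t + 1) := dvd_mul_right _ _
  set K := m * (N + r + t + 1)
  refine ⟨K, by omega, hN K (by omega) hmK, ?_, ?_, ?_⟩
  · have := (hN (K - r) (by omega) (Nat.dvd_sub hmK hd)).trans hr
    rwa [Nat.sub_add_cancel (by omega)] at this
  · have := ht.trans (hN (K - t) (by omega) (Nat.dvd_sub hmK hdt))
    rwa [Nat.add_sub_cancel' (by omega)] at this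
  · have := (ht.trans (hN (K - (r + t)) (by omega) (Nat.dvd_sub hmK hrt))).trans hr
    rwa [show t + (K - (r + t)) + r = K by omega] at this

/-! ### Positive entropy forces nontrivial chain pairs. -/

theorem expGrowthSup_nonpos_of_le_pow {u : ℕ → ENNReal} (C K : ℕ)
    (h : ∀ n, u n ≤ (((n + C) ^ K : ℕ) : ENNReal)) : ExpGrowth.expGrowthSup u ≤ 0 := by
  refine EReal.le_of_forall_lt_iff_le.1 fun a ha => ?_
  have ha' : 0 < a := by exact_mod_cast ha
  apply Eventually.expGrowthSup_le
  have h1 := (isLittleO_pow_exp_pos_mul_atTop K ha').comp_tendsto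
    (tendsto_natCast_atTop_atTop (R := ℝ))
  -- This constant absorbs the factor `2 ^ K` coming from `n + C ≤ 2 * n`.
  have h2 := h1.def (c := (1 / 2) ^ K) (by positivity)
  filter_upwards [h2, eventually_ge_atTop C] with n hn hC
  refine (h n).trans ?_
  have e : EReal.exp ((a : EReal) * (n : EReal)) = ENNReal.ofReal (Real.exp (a * n)) := by
    rw [← EReal.exp_coe]; simp
  rw [e, ← ENNReal.ofReal_natCast]
  apply ENNReal.ofReal_le_ofReal
  simp only [Function.comp, norm_pow, Real.norm_eq_abs, Real.abs_exp, Nat.abs_cast] at hn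
  have hC' : (C : ℝ) ≤ n := by exact_mod_cast hC
  calc (((n + C) ^ K : ℕ) : ℝ) = ((n : ℝ) + C) ^ K := by push_cast; ring
    _ ≤ (2 * (n : ℝ)) ^ K := by gcongr; linarith
    _ = 2 ^ K * (n : ℝ) ^ K := mul_pow _ _ _
    _ ≤ 2 ^ K * ((1 / 2) ^ K * Real.exp (a * n)) := by gcongr
    _ = Real.exp (a * n) := by rw [← mul_assoc, ← mul_pow]; norm_num

theorem hasChain_of_iterate_near {x y p : X} (hδ : 0 < δ) {i j : ℕ} (hij : i < j)
    (hx : dist (f (f^[i] p)) (f x) ≤ δ / 3) (hy : dist (f^[j] p) y ≤ δ / 3) :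
    HasChain f δ (j - i) x y := by
  have h := hasChain_iterate f (δ := δ / 3) (by positivity) (j - i) (f^[i] p)
  rw [← Function.iterate_add_apply, Nat.sub_add_cancel hij.le] at h
  rw [dist_comm] at hx
  exact (h.perturb (by omega) hx hy).mono (by linarith)

/-- If `x` and `y` are not linked at scale `δ`, then for small neighbourhoods `A`, `B` of them the
choices of `Aᶜ` or `Bᶜ` that are needed to follow all orbit segments of length `n` grow at most
linearly in `n`. -/
theorem exists_separating_words {x y : X} (hδ : 0 < δ)
    (hno : ¬ ∃ n : ℕ, 0 < n ∧ ChainLinked f δ n x y) {A B : Set X} (hAB : Disjoint A B)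
    (hA : ∀ a ∈ A, dist a x ≤ δ / 3 ∧ dist (f a) (f x) ≤ δ / 3)
    (hB : ∀ b ∈ B, dist b y ≤ δ / 3 ∧ dist (f b) (f y) ≤ δ / 3) :
    ∃ C : ℕ, ∀ n : ℕ, ∃ W : Finset (ℕ → Bool), W.card ≤ n + C ∧ ∀ p : X, ∃ w ∈ W, ∀ i < n,
      (w i = true → f^[i] p ∉ B) ∧ (w i = false → f^[i] p ∉ A) := by
  classical
  have hAA : ∀ p i j, i < j → f^[i] p ∈ A → f^[j] p ∈ A → HasChain f δ (j - i) x x :=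
    fun p i j hij h1 h2 => hasChain_of_iterate_near hδ hij (hA _ h1).2 (hA _ h2).1
  have hAB' : ∀ p i j, i < j → f^[i] p ∈ A → f^[j] p ∈ B → HasChain f δ (j - i) x y :=
    fun p i j hij h1 h2 => hasChain_of_iterate_near hδ hij (hA _ h1).2 (hB _ h2).1
  have hBA : ∀ p i j, i < j → f^[i] p ∈ B → f^[j] p ∈ A → HasChain f δ (j - i) y x :=
    fun p i j hij h1 h2 => hasChain_of_iterate_near hδ hij (hB _ h1).2 (hA _ h2).1
  have hdis : ∀ q, q ∈ A → q ∈ B → False := fun q h1 h2 => Set.disjoint_left.1 hAB h1 h2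
  by_cases hyx : ∃ t, 0 < t ∧ HasChain f δ t y x
  · by_cases hxy : ∃ r, 0 < r ∧ HasChain f δ r x y
    · obtain ⟨t, ht, hyx⟩ := hyx
      obtain ⟨r, hr, hxy⟩ := hxy
      have hnd : ∀ r, 0 < r → HasChain f δ r x y → ¬ chainPeriod f δ x ∣ r :=
        fun r hr hxy hd => hno (exists_chainLinked_of_dvd hxy hyx (by omega) hd)
      have hnd' : ∀ t, 0 < t → HasChain f δ t y x → ¬ chainPeriod f δ x ∣ t :=
        fun t ht hyx hd => hnd r hr hxy ((Nat.dvd_add_left hd).1 (chainPeriod_dvd (hxy.trans hyx)))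
      have hm0 : 0 < chainPeriod f δ x :=
        Nat.pos_of_dvd_of_pos (chainPeriod_dvd (hxy.trans hyx)) (by omega)
      have hdA : ∀ {n : ℕ}, HasChain f δ n x x → chainPeriod f δ x ∣ n := chainPeriod_dvd
      generalize chainPeriod f δ x = m at *
      -- All visits to `A` fall in one residue class mod `m`, and visits to `B` never fall in it. So
      -- the class alone dictates a valid word; the constant word serves orbits that miss `A`.
      refine ⟨m + 1, fun n => ⟨insert (fun _ => false)
        ((Finset.range m).image fun ρ i => decide (i % m = ρ)), ?_, fun p => ?_⟩⟩
      · refine (Finset.card_insert_le _ _).trans ?_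
        have := Finset.card_image_le (s := Finset.range m)
          (f := fun (ρ : ℕ) (i : ℕ) => decide (i % m = ρ))
        rw [Finset.card_range] at this
        omega
      · by_cases hp : ∃ i0, f^[i0] p ∈ A
        · obtain ⟨i0, hi0⟩ := hp
          refine ⟨fun i => decide (i % m = i0 % m), Finset.mem_insert_of_mem
            (Finset.mem_image.2 ⟨i0 % m, Finset.mem_range.2 (Nat.mod_lt _ hm0), rfl⟩), ?_⟩
          intro i _
          refine ⟨fun hw hiB => ?_, fun hw hiA => ?_⟩
          · have hmod : i % m = i0 % m := by simpa using hw
            rcases lt_trichotomy i i0 with h | rfl | h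
            · exact hnd' _ (by omega) (hBA p i i0 h hiB hi0)
                ((Nat.modEq_iff_dvd' h.le).1 hmod)
            · exact hdis _ hi0 hiB
            · exact hnd _ (by omega) (hAB' p i0 i h hi0 hiB)
                ((Nat.modEq_iff_dvd' h.le).1 hmod.symm)
          · have hmod : i % m ≠ i0 % m := by simpa using hw
            rcases lt_trichotomy i i0 with h | rfl | h
            · exact hmod ((Nat.modEq_iff_dvd' h.le).2 (hdA (hAA p i i0 h hiA hi0)))
            · exact hmod rfl
            · exact hmod ((Nat.modEq_iff_dvd' h.le).2 (hdA (hAA p i0 i h hi0 hiA))).symm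
        · push Not at hp
          exact ⟨fun _ => false, Finset.mem_insert_self _ _, fun i _ =>
            ⟨fun h => by simp at h, fun _ => hp i⟩⟩
    -- With no chain from `x` to `y`, the orbit cannot meet `B` after its first visit to `A`. The
    -- word switches at that time, or at `n` if there is none; the remaining case is the mirror
    -- image.
    · refine ⟨1, fun n => ⟨(Finset.range (n + 1)).image fun t i => decide (t ≤ i),
        Finset.card_image_le.trans (by simp), fun p => ?_⟩⟩
      by_cases hp : ∃ i, i < n ∧ f^[i] p ∈ A
      · refine ⟨fun i => decide (Nat.find hp ≤ i), Finset.mem_image.2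
          ⟨Nat.find hp, Finset.mem_range.2 (by have := (Nat.find_spec hp).1; omega), rfl⟩, ?_⟩
        intro i hi
        refine ⟨fun hw hiB => ?_, fun hw hiA => ?_⟩
        · have hle : Nat.find hp ≤ i := by simpa using hw
          rcases hle.lt_or_eq with h | h
          · exact hxy ⟨_, by omega, hAB' p _ i h (Nat.find_spec hp).2 hiB⟩
          · exact hdis _ (Nat.find_spec hp).2 (h ▸ hiB)
        · have hlt : i < Nat.find hp := by simpa using hw
          exact Nat.find_min hp hlt ⟨hi, hiA⟩
      · push Not at hp
        refine ⟨fun i => decide (n ≤ i), Finset.mem_image.2 ⟨n, by simp, rfl⟩, fun i hi => ?_⟩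
        exact ⟨fun hw => absurd hi (by simpa using hw), fun _ => hp i hi⟩
  · refine ⟨1, fun n => ⟨(Finset.range (n + 1)).image fun t i => decide (i < t),
      Finset.card_image_le.trans (by simp), fun p => ?_⟩⟩
    by_cases hp : ∃ i, i < n ∧ f^[i] p ∈ B
    · refine ⟨fun i => decide (i < Nat.find hp), Finset.mem_image.2
        ⟨Nat.find hp, Finset.mem_range.2 (by have := (Nat.find_spec hp).1; omega), rfl⟩, ?_⟩
      intro i hi
      refine ⟨fun hw hiB => ?_, fun hw hiA => ?_⟩
      · have hlt : i < Nat.find hp := by simpa using hw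
        exact Nat.find_min hp hlt ⟨hi, hiB⟩
      · have hle : Nat.find hp ≤ i := by simpa using hw
        rcases hle.lt_or_eq with h | h
        · exact hyx ⟨_, by omega, hBA p _ i h (Nat.find_spec hp).2 hiA⟩
        · exact hdis _ hiA (h ▸ (Nat.find_spec hp).2)
    · push Not at hp
      refine ⟨fun i => decide (i < n), Finset.mem_image.2 ⟨n, by simp, rfl⟩, fun i hi => ?_⟩
      exact ⟨fun _ => hp i hi, fun hw => absurd hi (by simpa using hw)⟩

theorem entropyRelCover_nonpos_of_words {X : Type*} {f : X → X} {A B : Set X} {C : ℕ}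
    (h : ∀ n : ℕ, ∃ W : Finset (ℕ → Bool), W.card ≤ n + C ∧ ∀ p : X, ∃ w ∈ W, ∀ i < n,
      (w i = true → f^[i] p ∉ B) ∧ (w i = false → f^[i] p ∉ A)) :
    entropyRelCover f {Aᶜ, Bᶜ} ≤ 0 := by
  classical
  refine expGrowthSup_nonpos_of_le_pow C 1 fun n => ?_
  obtain ⟨W, hW, hp⟩ := h n
  let g : (ℕ → Bool) → Set X := fun w => ⋂ i : Fin n, f^[(i : ℕ)] ⁻¹' (if w i then Bᶜ else Aᶜ)
  have hle : minSubcoverCard (iteratedJoin f {Aᶜ, Bᶜ} n) ≤ (W.image g : Set (Set X)).encard := by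
    refine iInf₂_le _ ⟨?_, ?_⟩
    · intro s hs
      obtain ⟨w, -, rfl⟩ := Finset.mem_image.1 (Finset.mem_coe.1 hs)
      refine ⟨fun i => if w i then Bᶜ else Aᶜ, fun i => ?_, rfl⟩
      dsimp only
      split_ifs <;> simp
    · refine Set.eq_univ_of_forall fun p => ?_
      obtain ⟨w, hw, hwp⟩ := hp p
      refine ⟨g w, Finset.mem_coe.2 (Finset.mem_image_of_mem g hw), Set.mem_iInter.2 fun i => ?_⟩
      have := hwp i i.2
      by_cases h : w i = true
      · simpa [h] using this.1 h
      · have h' : w i = false := by simpa using h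
        simpa [h'] using this.2 h'
  rw [Set.encard_coe_eq_coe_finsetCard] at hle
  have h2 : minSubcoverCard (iteratedJoin f {Aᶜ, Bᶜ} n) ≤ ((n + C : ℕ) : ℕ∞) :=
    hle.trans (by exact_mod_cast Finset.card_image_le.trans hW)
  have := ENat.toENNReal_mono h2
  simpa using this

/-- An unlinked scale would give disjoint closed balls around the two points whose complements form
a cover with subcovers of linear growth, hence of zero entropy. -/
theorem IsEntropyPair.chainPair (hf : Continuous f) {x y : X} (h : IsEntropyPair f x y) :
    ChainPair f x y := by
  intro δ hδ
  by_contra hno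
  have hxy : 0 < dist x y := dist_pos.2 h.1
  have h3 : 0 < δ / 3 := by positivity
  obtain ⟨η₁, hη₁, h₁⟩ := Metric.continuousAt_iff.1 (hf.continuousAt (x := x)) _ h3
  obtain ⟨η₂, hη₂, h₂⟩ := Metric.continuousAt_iff.1 (hf.continuousAt (x := y)) _ h3
  let η := min (min (η₁ / 2) (η₂ / 2)) (min (δ / 3) (dist x y / 3))
  have hη : 0 < η := by positivity
  have l1 : η ≤ η₁ / 2 := (min_le_left _ _).trans (min_le_left _ _)
  have l2 : η ≤ η₂ / 2 := (min_le_left _ _).trans (min_le_right _ _)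
  have l3 : η ≤ δ / 3 := (min_le_right _ _).trans (min_le_left _ _)
  have l4 : η ≤ dist x y / 3 := (min_le_right _ _).trans (min_le_right _ _)
  have hdis : Disjoint (Metric.closedBall x η) (Metric.closedBall y η) :=
    Metric.closedBall_disjoint_closedBall (by linarith)
  obtain ⟨C, hC⟩ := exists_separating_words hδ hno hdis
    (fun a ha => ⟨(Metric.mem_closedBall.1 ha).trans l3,
      (h₁ ((Metric.mem_closedBall.1 ha).trans_lt (by linarith))).le⟩)
    (fun b hb => ⟨(Metric.mem_closedBall.1 hb).trans l3,
      (h₂ ((Metric.mem_closedBall.1 hb).trans_lt (by linarith))).le⟩)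
  exact absurd (h.2 _ _ Metric.isClosed_closedBall (Metric.closedBall_mem_nhds x hη)
    Metric.isClosed_closedBall (Metric.closedBall_mem_nhds y hη) hdis.inter_eq)
    (entropyRelCover_nonpos_of_words hC).not_gt

theorem exists_finset_representatives {α β : Type*} (g : α → β) (D : Finset β)
    (h : ∀ a, g a ∈ D) : ∃ s : Finset α, s.card ≤ D.card ∧ ∀ a, ∃ b ∈ s, g a = g b := by
  classical
  rcases isEmpty_or_nonempty α with hα | hα
  · exact ⟨∅, by simp, fun a => (hα.false a).elim⟩
  · refine ⟨D.image (Function.invFun g), Finset.card_image_le, fun a => ?_⟩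
    exact ⟨_, Finset.mem_image_of_mem _ (h a), (Function.invFun_eq ⟨a, rfl⟩).symm⟩

theorem exists_chainPair_of_topEntropy_pos [CompactSpace X] (hf : Continuous f)
    (hent : 0 < topEntropy f) : ∃ x y, x ≠ y ∧ ChainPair f x y := by
  classical
  by_contra hcon
  push Not at hcon
  refine hent.not_ge (iSup₂_le fun U hU => ?_)
  obtain ⟨ε, hε, hεU⟩ := Metric.mem_uniformity_dist.1 hU
  -- Compactness gives one scale at which no pair at distance at least `ε / 2` is linked; otherwise
  -- such pairs would accumulate at an off-diagonal chain pair.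
  obtain ⟨δ, hδ, hno⟩ : ∃ δ : ℝ, 0 < δ ∧ ∀ x y : X, ε / 2 ≤ dist x y →
      ¬ ∃ n : ℕ, 0 < n ∧ ChainLinked f δ n x y := by
    by_contra hc
    push Not at hc
    have hK : IsCompact {p : X × X | ε / 2 ≤ dist p.1 p.2} :=
      (isClosed_le continuous_const continuous_dist).isCompact
    obtain ⟨p, hp, hpair⟩ := exists_chainPair_of_isCompact hf hK fun δ hδ => by
      obtain ⟨x, y, hd, n, hn, hl⟩ := hc δ hδ
      exact ⟨(x, y), hd, n, hn, hl⟩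
    have hp' : ε / 2 ≤ dist p.1 p.2 := hp
    by_cases he : p.1 = p.2
    · rw [he, dist_self] at hp'
      linarith
    · exact hcon _ _ he hpair
  obtain ⟨η₁, hη₁, hmod⟩ := Metric.uniformContinuous_iff.1
    (CompactSpace.uniformContinuous_of_continuous hf) (δ / 3) (by positivity)
  let η := min η₁ (min (δ / 3) (ε / 8))
  have hη : 0 < η := by positivity
  have l1 : η ≤ η₁ := min_le_left _ _
  have l2 : η ≤ δ / 3 := (min_le_right _ _).trans (min_le_left _ _)
  have l3 : η ≤ ε / 8 := (min_le_right _ _).trans (min_le_right _ _)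
  obtain ⟨T, hTfin, hT⟩ := Metric.totallyBounded_iff.1
    (isCompact_univ (X := X)).totallyBounded η hη
  have hT' : ∀ p : X, ∃ e : hTfin.toFinset, dist p e < η := by
    intro p
    obtain ⟨e, he, hpe⟩ := Set.mem_iUnion₂.1 (hT (Set.mem_univ p))
    exact ⟨⟨e, hTfin.mem_toFinset.2 he⟩, hpe⟩
  generalize hTfin.toFinset = T' at hT'
  -- The code of a point is its tuple of separating words, one for each pair of centres. Two points
  -- with the same code cannot be near far-apart centres at the same time, so they stay `ε`-close
  -- for `n` steps, and the number of codes is polynomial in `n`.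
  have hwords : ∀ q : T' × T', ∃ C : ℕ, ∀ n : ℕ, ∃ W : Finset (ℕ → Bool), W.card ≤ n + C ∧
      ∀ p : X, ∃ w ∈ W, ε / 2 ≤ dist (q.1 : X) q.2 → ∀ i < n,
        (w i = true → f^[i] p ∉ Metric.ball (q.2 : X) η) ∧
        (w i = false → f^[i] p ∉ Metric.ball (q.1 : X) η) := by
    rintro ⟨a, b⟩
    by_cases hd : ε / 2 ≤ dist (a : X) b
    · obtain ⟨C, hC⟩ := exists_separating_words hδ (hno a b hd)
        (A := Metric.ball (a : X) η) (B := Metric.ball (b : X) η)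
        (Metric.ball_disjoint_ball (by linarith))
        (fun u hu => ⟨(Metric.mem_ball.1 hu).le.trans l2, (hmod (lt_of_lt_of_le hu l1)).le⟩)
        (fun u hu => ⟨(Metric.mem_ball.1 hu).le.trans l2, (hmod (lt_of_lt_of_le hu l1)).le⟩)
      refine ⟨C, fun n => ?_⟩
      obtain ⟨W, hW, hp⟩ := hC n
      refine ⟨W, hW, fun p => ?_⟩
      obtain ⟨w, hw, hwp⟩ := hp p
      exact ⟨w, hw, fun _ => hwp⟩
    · exact ⟨1, fun n => ⟨{fun _ => true}, by simp, fun p => ⟨_, Finset.mem_singleton_self _,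
        fun h => absurd h hd⟩⟩⟩
  choose C W hW code hcode hsep using hwords
  refine expGrowthSup_nonpos_of_le_pow (∑ q, C q) (Fintype.card (T' × T')) fun n => ?_
  obtain ⟨s, hs, hrep⟩ := exists_finset_representatives (fun p q => code q n p)
    (Fintype.piFinset fun q => W q n) (fun p => Fintype.mem_piFinset.2 fun q => hcode q n p)
  have hcover : Dynamics.IsDynCoverOf f Set.univ U n (s : Set X) := by
    intro p _
    obtain ⟨p', hp', heq⟩ := hrep p
    refine ⟨p', hp', Dynamics.mem_dynEntourage.2 fun i hi => hεU ?_⟩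
    obtain ⟨a, ha⟩ := hT' (f^[i] p)
    obtain ⟨b, hb⟩ := hT' (f^[i] p')
    by_cases hd : ε / 2 ≤ dist (a : X) b
    · exfalso
      have h1 := hsep (a, b) n p hd i hi
      have h2 := hsep (a, b) n p' hd i hi
      rw [← congrFun heq (a, b)] at h2
      cases hw : code (a, b) n p i
      · exact h1.2 hw ha
      · exact h2.1 hw hb
    · push Not at hd
      have := dist_triangle4 (f^[i] p) a b (f^[i] p')
      rw [dist_comm] at hb
      linarith
  have h1 := hcover.coverMincard_le_card
  have h2 : s.card ≤ (n + ∑ q, C q) ^ Fintype.card (T' × T') := by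
    refine hs.trans ?_
    rw [Fintype.card_piFinset, ← Finset.card_univ]
    refine Finset.prod_le_pow_card _ _ _ fun q _ => (hW q n).trans ?_
    gcongr
    exact Finset.single_le_sum (f := C) (fun _ _ => Nat.zero_le _) (Finset.mem_univ q)
  have h3 : Dynamics.coverMincard f Set.univ U n ≤
      (((n + ∑ q, C q) ^ Fintype.card (T' × T') : ℕ) : ℕ∞) := h1.trans (by exact_mod_cast h2)
  exact (ENat.toENNReal_mono h3).trans_eq (ENat.toENNReal_coe _)

/-! ### From limit shadowing to orbits that follow words. -/

/-- Concatenation of blocks with errors tending to zero gives a limit pseudo orbit. -/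
theorem exists_isLimitPseudoOrbit_of_blocks {M : ℕ → ℕ} (hM0 : M 0 = 0) (hM : StrictMono M)
    (B : ℕ → ℕ → X) {η : ℕ → ℝ} (hη : Tendsto η atTop (𝓝 0))
    (hstep : ∀ k i, M k + i < M (k + 1) → dist (f (B k i)) (B k (i + 1)) ≤ η k)
    (hjoin : ∀ k, dist (B k (M (k + 1) - M k)) (B (k + 1) 0) ≤ η k) :
    ∃ ξ : ℕ → X, IsLimitPseudoOrbit f ξ ∧ ∀ k i, M k + i < M (k + 1) → ξ (M k + i) = B k i := by
  have hst : ∀ j, ∃ k, M k ≤ j ∧ j < M (k + 1) := by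
    intro j
    refine ⟨Nat.findGreatest (fun k => M k ≤ j) j, ?_, ?_⟩
    · exact Nat.findGreatest_spec (P := fun k => M k ≤ j) (Nat.zero_le j) (by simp [hM0])
    · by_contra h
      push Not at h
      have h1 := hM.le_apply (x := Nat.findGreatest (fun k => M k ≤ j) j + 1)
      exact Nat.findGreatest_is_greatest (P := fun k => M k ≤ j) (Nat.lt_succ_self _)
        (h1.trans h) h
  choose st hst1 hst2 using hst
  have huniq : ∀ k i, M k + i < M (k + 1) → st (M k + i) = k := by
    intro k i h
    have h1 : M k < M (st (M k + i) + 1) := (Nat.le_add_right _ _).trans_lt (hst2 _)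
    have h2 : M (st (M k + i)) < M (k + 1) := (hst1 _).trans_lt h
    have := hM.lt_iff_lt.1 h1
    have := hM.lt_iff_lt.1 h2
    omega
  refine ⟨fun j => B (st j) (j - M (st j)), ?_, fun k i h => by simp [huniq k i h]⟩
  rw [IsLimitPseudoOrbit, Metric.tendsto_atTop]
  intro ε hε
  obtain ⟨k₀, hk₀⟩ := Metric.tendsto_atTop.1 hη (ε / 2) (by positivity)
  refine ⟨M k₀, fun j hj => ?_⟩
  rw [Real.dist_0_eq_abs, abs_of_nonneg dist_nonneg]
  obtain ⟨k, i, rfl, hi⟩ : ∃ k i, j = M k + i ∧ M k + i < M (k + 1) :=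
    ⟨st j, j - M (st j), by have := hst1 j; omega, by have := hst1 j; have := hst2 j; omega⟩
  have hk : k₀ ≤ k := by
    have := hM.lt_iff_lt.1 (hj.trans_lt hi)
    omega
  have he : η k < ε / 2 := by
    have := hk₀ k hk
    rw [Real.dist_0_eq_abs] at this
    exact (le_abs_self _).trans_lt this
  simp only [huniq k i hi, Nat.add_sub_cancel_left]
  have h1 := hstep k i hi
  by_cases hlast : M k + (i + 1) < M (k + 1)
  · rw [add_assoc, huniq k _ hlast, Nat.add_sub_cancel_left]
    linarith
  · have hnext : M k + i + 1 = M (k + 1) + 0 := by omega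
    have h0 : M (k + 1) + 0 < M (k + 1 + 1) := hM (Nat.lt_succ_self _)
    rw [hnext, huniq _ _ h0, Nat.add_sub_cancel_left]
    have h2 := hjoin k
    rw [show M (k + 1) - M k = i + 1 by omega] at h2
    have := dist_triangle (f (B k i)) (B k (i + 1)) (B (k + 1) 0)
    linarith

/-- Limit shadowing implies that closed chains with small errors are shadowed by orbits. -/
theorem HasLimitShadowing.exists_shadowing_loops [CompactSpace X] (h : HasLimitShadowing f)
    {ε : ℝ} (hε : 0 < ε) : ∃ δ : ℝ, 0 < δ ∧ ∀ (n : ℕ) (c : ℕ → X), 0 < n → c n = c 0 →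
      (∀ i < n, dist (f (c i)) (c (i + 1)) < δ) → ∃ p, ∀ i < n, dist (f^[i] p) (c i) < ε := by
  by_contra hcon
  push Not at hcon
  have h' : ∀ k : ℕ, _ := fun k => hcon (1 / ((k : ℝ) + 1)) (by positivity)
  choose n c hn hloop hstep hbad using h'
  -- Bad loops with converging base points can be concatenated with errors tending to zero, because
  -- each loop ends where it began. A limit shadowing point then follows some late bad loop within
  -- `ε`.
  obtain ⟨a, -, φ, hφ, hlim⟩ := isCompact_univ.tendsto_subseq (x := fun k => c k 0)
    (fun _ => Set.mem_univ _)
  let M : ℕ → ℕ := fun k => ∑ j ∈ Finset.range k, n (φ j)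
  have hMs : ∀ k, M (k + 1) = M k + n (φ k) := fun k => Finset.sum_range_succ _ _
  have hM : StrictMono M := strictMono_nat_of_lt_succ fun k => by
    have := hn (φ k)
    rw [hMs]
    omega
  have hη1 := (tendsto_one_div_add_atTop_nhds_zero_nat (𝕜 := ℝ)).comp hφ.tendsto_atTop
  have hη2 : Tendsto (fun k => dist (c (φ k) 0) (c (φ (k + 1)) 0)) atTop (𝓝 0) := by
    have := hlim.dist (hlim.comp (tendsto_add_atTop_nat 1))
    rwa [dist_self] at this
  have hη : Tendsto (fun k => 1 / ((φ k : ℝ) + 1) + dist (c (φ k) 0) (c (φ (k + 1)) 0))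
      atTop (𝓝 0) := by
    have := hη1.add hη2
    rwa [add_zero] at this
  obtain ⟨ξ, hξ, hξB⟩ := exists_isLimitPseudoOrbit_of_blocks (f := f) (M := M) (by simp [M]) hM
    (fun k => c (φ k)) hη
    (fun k i hi => (hstep (φ k) i (by rw [hMs] at hi; omega)).le.trans
      (le_add_of_nonneg_right dist_nonneg))
    (fun k => by
      rw [hMs, Nat.add_sub_cancel_left, hloop]
      exact le_add_of_nonneg_left (by positivity))
  obtain ⟨p, hp⟩ := h ξ hξ
  obtain ⟨N, hN⟩ := Metric.tendsto_atTop.1 hp ε hε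
  obtain ⟨i, hi, hd⟩ := hbad (φ N) (f^[M N] p)
  have h1 := hN (M N + i) ((hM.le_apply).trans (Nat.le_add_right _ _))
  rw [Real.dist_0_eq_abs, abs_of_nonneg dist_nonneg, hξB N i (by rw [hMs]; omega), add_comm,
    Function.iterate_add_apply] at h1
  exact hd.not_gt h1

/-- The word is read cyclically modulo `N`, so that the chain closes up and loop shadowing applies.
-/
theorem exists_isChain_through_word {n N : ℕ} (hn : 0 < n) {x y : X}
    (h : ChainLinked f δ n x y) (v : ℕ → Bool) :
    ∃ c : ℕ → X, c (n * N) = c 0 ∧ (∀ i, dist (f (c i)) (c (i + 1)) < δ) ∧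
      ∀ k < N, c (n * k) = if v k then x else y := by
  have hG : ∀ a b : Bool, HasChain f δ n (if a then x else y) (if b then x else y) := by
    rintro (_ | _) (_ | _)
    exacts [h.2.2.2, h.2.2.1, h.2.1, h.1]
  choose G hG0 hGn hGs using hG
  refine ⟨fun j => G (v (j / n % N)) (v ((j / n + 1) % N)) (j % n), ?_, fun j => ?_,
    fun k hk => ?_⟩
  · simp [hG0, hn]
  · dsimp only
    have hlt := Nat.mod_lt j hn
    have hs := hGs (v (j / n % N)) (v ((j / n + 1) % N)) (j % n) hlt
    by_cases hj : j % n + 1 < n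
    · have h1 : (j + 1) % n = j % n + 1 := by
        rw [Nat.add_mod, Nat.mod_eq_of_lt (a := 1) (by omega), Nat.mod_eq_of_lt hj]
      have h2 : (j + 1) / n = j / n := by
        rw [Nat.div_eq_iff hn]
        have := Nat.div_add_mod j n
        have := Nat.mul_comm n (j / n)
        omega
      rwa [h1, h2]
    · have h0 := Nat.div_add_mod j n
      have h3 : j + 1 = n * (j / n + 1) := by rw [mul_add]; omega
      have h1 : (j + 1) % n = 0 := by rw [h3]; simp
      have h2 : (j + 1) / n = j / n + 1 := by rw [h3]; exact Nat.mul_div_cancel_left _ hn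
      rw [show j % n + 1 = n by omega, hGn] at hs
      rwa [h1, h2, hG0]
  · simp [hG0, Nat.mul_div_cancel_left _ hn, Nat.mod_eq_of_lt hk]

/-- Finite words are followed by shadowing loops, and compactness passes to infinite ones. The step
`n` depends on `ε` only, not on the word. -/
theorem exists_orbit_following_word [CompactSpace X] (hf : Continuous f)
    (h : HasLimitShadowing f) {x y : X} (hxy : ChainPair f x y) {ε : ℝ} (hε : 0 < ε) :
    ∃ n : ℕ, 0 < n ∧ ∀ v : ℕ → Bool,
      ∃ p : X, ∀ k, dist (f^[n * k] p) (if v k then x else y) ≤ ε := by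
  obtain ⟨δ, hδ, hsh⟩ := h.exists_shadowing_loops hε
  obtain ⟨n, hn, hl⟩ := hxy δ hδ
  refine ⟨n, hn, fun v => ?_⟩
  let K : ℕ → Set X := fun N => {p | ∀ k ≤ N, dist (f^[n * k] p) (if v k then x else y) ≤ ε}
  have hclosed : ∀ N, IsClosed (K N) := by
    intro N
    simp only [K, Set.ofPred_forall]
    exact isClosed_iInter fun k => isClosed_iInter fun _ =>
      isClosed_le ((hf.iterate _).dist continuous_const) continuous_const
  obtain ⟨p, hp⟩ := IsCompact.nonempty_iInter_of_sequence_nonempty_isCompact_isClosed K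
    (fun N p hp k hk => hp k (by omega))
    (fun N => by
      obtain ⟨c, hc, hs, hv⟩ := exists_isChain_through_word (N := N + 1) hn hl v
      obtain ⟨p, hp⟩ := hsh (n * (N + 1)) c (by positivity) hc fun i _ => hs i
      refine ⟨p, fun k hk => ?_⟩
      rw [← hv k (by omega)]
      exact (hp (n * k) (Nat.mul_lt_mul_of_pos_left (by omega) hn)).le)
    (hclosed 0).isCompact hclosed
  exact ⟨p, fun k => Set.mem_iInter.1 hp k k le_rfl⟩

/-! ### Recurrent distal chain pairs. -/

/-- An orbit segment from near `a` to a later time near `b` becomes a chain once its ends are moved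
to `a` and `b`. -/
theorem exists_hasChain_of_mapClusterPt (hf : Continuous f) {n : ℕ} (hn : 0 < n) {p a b : X}
    (ha : MapClusterPt a atTop fun k => f^[n * k] p)
    (hb : MapClusterPt b atTop fun k => f^[n * k] p) (hδ : 0 < δ) :
    ∃ k, 0 < k ∧ HasChain f δ (n * k) a b := by
  have h1 := mapClusterPt_iff_frequently.1 ha _
    (hf.continuousAt.preimage_mem_nhds (Metric.ball_mem_nhds (f a) (show 0 < δ / 3 by positivity)))
  obtain ⟨i, hi⟩ := h1.exists
  have h2 := mapClusterPt_iff_frequently.1 hb _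
    (Metric.ball_mem_nhds b (show 0 < δ / 3 by positivity))
  obtain ⟨j, hj, hjb⟩ := frequently_atTop.1 h2 (i + 1)
  refine ⟨j - i, by omega, ?_⟩
  rw [Nat.mul_sub]
  exact hasChain_of_iterate_near hδ (Nat.mul_lt_mul_of_pos_left (by omega) hn)
    (le_of_lt hi) (le_of_lt hjb)

theorem mapClusterPt_iterate (hf : Continuous f) {n : ℕ} {p a : X}
    (ha : MapClusterPt a atTop fun k => f^[n * k] p) (j : ℕ) :
    MapClusterPt (f^[n * j] a) atTop fun k => f^[n * k] p := by
  refine mapClusterPt_iff_frequently.2 fun s hs => frequently_atTop.2 fun N => ?_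
  have h := mapClusterPt_iff_frequently.1 ha _
    ((hf.iterate (n * j)).continuousAt.preimage_mem_nhds hs)
  obtain ⟨k, hk, hks⟩ := frequently_atTop.1 h N
  refine ⟨j + k, by omega, ?_⟩
  rw [mul_add, Function.iterate_add_apply]
  exact hks

/-- Cluster points of an orbit of `f^n` along times after which it stays near `q`. -/
theorem exists_mapClusterPt_near [CompactSpace X] (hf : Continuous f) {n : ℕ} {p q : X} {ε : ℝ}
    {m : ℕ → ℕ} (hm : Tendsto m atTop atTop)
    (h : ∀ i, ∀ᶠ j in atTop, dist (f^[n * (i + m j)] p) q ≤ ε) :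
    ∃ z, MapClusterPt z atTop (fun k => f^[n * k] p) ∧ ∀ k, dist (f^[n * k] z) q ≤ ε := by
  obtain ⟨z, -, φ, hφ, hlim⟩ := isCompact_univ.tendsto_subseq (x := fun j => f^[n * m j] p)
    (fun _ => Set.mem_univ _)
  refine ⟨z, ?_, fun i => ?_⟩
  · exact (MapClusterPt.of_comp (φ := m ∘ φ) (hm.comp hφ.tendsto_atTop) hlim.mapClusterPt)
  · have h1 := (((hf.iterate (n * i)).tendsto z).comp hlim).dist (tendsto_const_nhds (x := q))
    refine le_of_tendsto h1 ?_
    filter_upwards [hφ.tendsto_atTop.eventually (h i)] with j hj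
    simpa only [Function.comp, ← Function.iterate_add_apply, ← mul_add] using hj

/-- Near a pair linked at every scale there is such a pair which returns near it periodically. -/
theorem exists_chainPair_near [CompactSpace X] (hf : Continuous f)
    (h : HasLimitShadowing f) {x y : X} (hxy : ChainPair f x y) {ε : ℝ} (hε : 0 < ε) :
    ∃ n : ℕ, 0 < n ∧ ∃ z w : X, ChainPair f z w ∧
      ∀ k, dist (f^[n * k] z) x ≤ ε ∧ dist (f^[n * k] w) y ≤ ε := by
  obtain ⟨n, hn, hword⟩ := exists_orbit_following_word hf h hxy hε
  -- The word is constant on each block from `2 ^ j` to `2 ^ (j + 1)` and alternates with the parity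
  -- of `j`. Limits along block starts of fixed parity therefore stay near one point forever.
  obtain ⟨p, hp⟩ := hword fun k => decide (Nat.log 2 k % 2 = 0)
  have hev : ∀ i : ℕ, ∀ᶠ j : ℕ in atTop, i < 2 ^ j := fun i =>
    (tendsto_pow_atTop_atTop_of_one_lt one_lt_two).eventually_gt_atTop i
  have hlog : ∀ i j : ℕ, i < 2 ^ j → Nat.log 2 (i + 2 ^ j) = j := fun i j hij =>
    Nat.log_eq_of_pow_le_of_lt_pow (by omega) (by rw [pow_succ]; omega)
  have t1 : Tendsto (fun j : ℕ => 2 * j) atTop atTop :=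
    tendsto_atTop_mono (fun j => by simp only [id]; omega) tendsto_id
  have t2 : Tendsto (fun j : ℕ => 2 * j + 1) atTop atTop :=
    tendsto_atTop_mono (fun j => by simp only [id]; omega) tendsto_id
  have tp : Tendsto (fun j : ℕ => 2 ^ j) atTop atTop :=
    tendsto_pow_atTop_atTop_of_one_lt one_lt_two
  obtain ⟨z, hz, hzx⟩ := exists_mapClusterPt_near hf (n := n) (p := p) (q := x) (ε := ε)
    (tp.comp t1) fun i => by
      filter_upwards [t1.eventually (hev i)] with j hj
      have := hp (i + 2 ^ (2 * j))
      simpa [hlog _ _ hj] using this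
  obtain ⟨w, hw, hwy⟩ := exists_mapClusterPt_near hf (n := n) (p := p) (q := y) (ε := ε)
    (tp.comp t2) fun i => by
      filter_upwards [t2.eventually (hev i)] with j hj
      have := hp (i + 2 ^ (2 * j + 1))
      simpa [hlog _ _ hj, Nat.add_mod] using this
  let K : Set (X × X) := {q | ∀ k, dist (f^[n * k] q.1) x ≤ ε ∧ dist (f^[n * k] q.2) y ≤ ε}
  have hK : IsClosed K := by
    simp only [K, Set.ofPred_forall]
    exact isClosed_iInter fun k =>
      (isClosed_le (((hf.iterate _).comp continuous_fst).dist continuous_const)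
        continuous_const).inter
      (isClosed_le (((hf.iterate _).comp continuous_snd).dist continuous_const) continuous_const)
  obtain ⟨q, hq, hpair⟩ := exists_chainPair_of_isCompact hf hK.isCompact fun δ hδ => by
    obtain ⟨r, hr, hzw⟩ := exists_hasChain_of_mapClusterPt hf hn hz hw hδ
    obtain ⟨t, ht, hzz⟩ := exists_hasChain_of_mapClusterPt hf hn hz hz hδ
    have hm : 0 < chainPeriod f δ z :=
      Nat.pos_of_dvd_of_pos (chainPeriod_dvd hzz) (by positivity)
    set m := chainPeriod f δ z with hmdef
    -- Moving `w` forward by `n * ((m - 1) * r)` lengthens the chain of length `n * r` to `n * m *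
    -- r`, a multiple of the period, while the new point still stays near `y`.
    have hw' := mapClusterPt_iterate hf hw ((m - 1) * r)
    obtain ⟨s, hs, hback⟩ := exists_hasChain_of_mapClusterPt hf hn hw' hz hδ
    have hto := hzw.trans (hasChain_iterate f hδ (n * ((m - 1) * r)) w)
    obtain ⟨l, hl, hlink⟩ := exists_chainLinked_of_dvd hto hback
      (by have : 0 < n * s := by positivity
          omega)
      ⟨n * r, by
        obtain ⟨m', hm'⟩ : ∃ m', m = m' + 1 := ⟨m - 1, by omega⟩
        rw [← hmdef, hm', Nat.add_sub_cancel]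
        ring⟩
    refine ⟨(z, f^[n * ((m - 1) * r)] w), fun k => ⟨hzx k, ?_⟩, l, hl, hlink⟩
    simpa only [← Function.iterate_add_apply, ← mul_add] using hwy (k + (m - 1) * r)
  exact ⟨n, hn, q.1, q.2, hpair, hq⟩

/-- Birkhoff's argument: in a minimal closed invariant set, the closure of the orbit from time one
onwards is the whole set, hence contains the starting point. -/
theorem exists_recurrent_point {Y : Type*} [MetricSpace Y] {g : Y → Y} (hg : Continuous g)
    {K : Set Y} (hK : IsCompact K) (hne : K.Nonempty) (hgK : Set.MapsTo g K K) :
    ∃ p ∈ K, ∀ ε : ℝ, 0 < ε → ∃ T : ℕ, 0 < T ∧ dist (g^[T] p) p < ε := by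
  let S : Set (Set Y) := {L | L ⊆ K ∧ IsClosed L ∧ L.Nonempty ∧ Set.MapsTo g L L}
  obtain ⟨L, hLK, hL⟩ := zorn_superset_nonempty S (by
    intro c hc hchain hcne
    have hcne' : Nonempty c := hcne.to_subtype
    refine ⟨⋂₀ c, ⟨?_, ?_, ?_, ?_⟩, fun s hs => Set.sInter_subset_of_mem hs⟩
    · obtain ⟨s, hs⟩ := hcne
      exact (Set.sInter_subset_of_mem hs).trans (hc hs).1
    · exact isClosed_sInter fun s hs => (hc hs).2.1
    · refine IsCompact.nonempty_sInter_of_directed_nonempty_isCompact_isClosed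
        (fun s hs t ht => (hchain.total hs ht).elim (fun h => ⟨s, hs, subset_rfl, h⟩)
          fun h => ⟨t, ht, h, subset_rfl⟩) (fun s hs => (hc hs).2.2.1)
        (fun s hs => hK.of_isClosed_subset (hc hs).2.1 (hc hs).1) (fun s hs => (hc hs).2.1)
    · exact fun p hp s hs => (hc hs).2.2.2 (hp s hs)) K ⟨subset_rfl, hK.isClosed, hne, hgK⟩
  obtain ⟨-, hLc, ⟨p, hp⟩, hLg⟩ := hL.prop
  refine ⟨p, hLK hp, fun ε hε => ?_⟩
  have hsub : closure (Set.range fun k => g^[k + 1] p) ⊆ L :=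
    closure_minimal (Set.range_subset_iff.2 fun k => hLg.iterate (k + 1) hp) hLc
  have hmem : closure (Set.range fun k => g^[k + 1] p) ∈ S := by
    refine ⟨hsub.trans hLK, isClosed_closure, (Set.range_nonempty _).closure, ?_⟩
    refine Set.MapsTo.closure ?_ hg
    rintro _ ⟨k, rfl⟩
    exact ⟨k + 1, Function.iterate_succ_apply' g (k + 1) p⟩
  obtain ⟨_, ⟨k, rfl⟩, hk⟩ := Metric.mem_closure_iff.1 (hL.le_of_le hmem hsub hp) ε hε
  exact ⟨k + 1, Nat.succ_pos k, by rwa [dist_comm]⟩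

/-- Near a pair of distinct points linked at every scale there is a recurrent distal pair that is
linked at every scale. -/
theorem exists_recurrent_distal_chainPair [CompactSpace X] (hf : Continuous f)
    (h : HasLimitShadowing f) {x y : X} (hxy : ChainPair f x y) (hne : x ≠ y) {ε : ℝ}
    (hε : 0 < ε) :
    ∃ z w : X, ChainPair f z w ∧ dist z x ≤ ε ∧ dist w y ≤ ε ∧
      (∃ c : ℝ, 0 < c ∧ ∀ i, c ≤ dist (f^[i] z) (f^[i] w)) ∧
      ∀ η : ℝ, 0 < η → ∃ T : ℕ, 0 < T ∧ dist (f^[T] z) z < η ∧ dist (f^[T] w) w < η := by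
  have hd : 0 < dist x y := dist_pos.2 hne
  set ε' := min ε (dist x y / 3)
  have hε'0 : 0 < ε' := by positivity
  obtain ⟨n, hn, z₀, w₀, hpair₀, hnear₀⟩ := exists_chainPair_near hf h hxy hε'0
  let K : Set (X × X) := {q | ChainPair f q.1 q.2} ∩
    {q | ∀ k, dist (f^[n * k] q.1) x ≤ ε' ∧ dist (f^[n * k] q.2) y ≤ ε'}
  have hK : IsClosed K := by
    refine (isClosed_setOf_chainPair hf).inter ?_
    simp only [Set.ofPred_forall]
    exact isClosed_iInter fun k =>
      (isClosed_le (((hf.iterate _).comp continuous_fst).dist continuous_const)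
        continuous_const).inter
      (isClosed_le (((hf.iterate _).comp continuous_snd).dist continuous_const) continuous_const)
  have hKg : Set.MapsTo (Prod.map f^[n] f^[n]) K K := by
    rintro q ⟨h1, h2⟩
    refine ⟨ChainPair.iterate hf h1 n, fun k => ?_⟩
    have := h2 (k + 1)
    rw [mul_add, mul_one] at this
    simpa only [Prod.map_fst, Prod.map_snd, ← Function.iterate_add_apply] using this
  obtain ⟨⟨z, w⟩, ⟨hpair, hnear⟩, hrec⟩ := exists_recurrent_point
    ((hf.iterate n).prodMap (hf.iterate n)) hK.isCompact ⟨(z₀, w₀), hpair₀, hnear₀⟩ hKg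
  refine ⟨z, w, hpair, (hnear 0).1.trans (min_le_left _ _), (hnear 0).2.trans (min_le_left _ _),
    ?_, fun η hη => ?_⟩
  -- At multiples of `n` the two orbits are at least `dist x y / 3` apart. If they were too close at
  -- time `i`, uniform continuity of the iterates up to `n` would carry this to the next multiple of
  -- `n`.
  · have hmod : ∀ j : ℕ, ∃ c : ℝ, 0 < c ∧ ∀ u v : X, dist u v < c →
        dist (f^[j] u) (f^[j] v) < dist x y / 3 := by
      intro j
      obtain ⟨c, hc, hcm⟩ := Metric.uniformContinuous_iff.1
        (CompactSpace.uniformContinuous_of_continuous (hf.iterate j)) (dist x y / 3)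
        (by positivity)
      exact ⟨c, hc, fun u v huv => hcm huv⟩
    choose c hc hcm using hmod
    obtain ⟨j₀, -, hj₀⟩ := Finset.exists_min_image (Finset.range (n + 1)) c ⟨0, by simp⟩
    refine ⟨c j₀, hc j₀, fun i => ?_⟩
    by_contra hlt
    push Not at hlt
    have hle : n * (i / n) + i % n = i := Nat.div_add_mod i n
    have hml := Nat.mod_lt i hn
    have h1 := hcm (n - i % n) _ _ (hlt.trans_le (hj₀ (n - i % n) (by simp)))
    rw [← Function.iterate_add_apply, ← Function.iterate_add_apply,
      show n - i % n + i = n * (i / n + 1) by rw [mul_add]; omega] at h1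
    have h2 := hnear (i / n + 1)
    have h3 : ε' ≤ dist x y / 3 := min_le_right _ _
    have h4 := dist_triangle4 x (f^[n * (i / n + 1)] z) (f^[n * (i / n + 1)] w) y
    rw [dist_comm x (f^[n * (i / n + 1)] z)] at h4
    have h5 := h2.1
    have h6 := h2.2
    dsimp only at h5 h6
    linarith
  · obtain ⟨T, hT, hdist⟩ := hrec η hη
    rw [Prod.map_iterate, ← Function.iterate_mul, Prod.dist_eq, max_lt_iff] at hdist
    exact ⟨n * T, by positivity, hdist.1, hdist.2⟩

/-! ### Scheduled orbits and their distributional behaviour. -/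

/-- A window of length `L k` starting at `M k` outweighs its past by a factor of at least `k + 1`,
so the density measured at the end of good windows tends to one. -/
theorem limsup_density_eq_one {A : ℕ → Prop} {M L : ℕ → ℕ}
    (hL : ∀ k, (k + 1) * (M k + 1) ≤ L k)
    (h : ∃ᶠ k in atTop, ∀ i < L k, A (M k + i)) :
    limsup (fun n : ℕ => (Set.ncard {i : ℕ | i < n ∧ A i} : ℝ) / (n : ℝ)) atTop = 1 := by
  have hfin : ∀ n, {i : ℕ | i < n ∧ A i}.Finite := fun n =>
    (Set.finite_Iio n).subset fun i hi => hi.1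
  have hle : ∀ n : ℕ, (Set.ncard {i : ℕ | i < n ∧ A i} : ℝ) / (n : ℝ) ≤ 1 := by
    intro n
    refine div_le_one_of_le₀ ?_ (Nat.cast_nonneg n)
    have := Set.ncard_le_ncard (s := {i : ℕ | i < n ∧ A i}) (t := Set.Iio n) (fun i hi => hi.1)
      (Set.finite_Iio n)
    rw [Set.ncard_Iio_nat] at this
    exact_mod_cast this
  have hge : ∀ n : ℕ, 0 ≤ (Set.ncard {i : ℕ | i < n ∧ A i} : ℝ) / (n : ℝ) :=
    fun n => by positivity
  have hbdd : IsBoundedUnder (· ≤ ·) atTop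
      fun n : ℕ => (Set.ncard {i : ℕ | i < n ∧ A i} : ℝ) / (n : ℝ) :=
    isBoundedUnder_of ⟨1, hle⟩
  refine le_antisymm (limsup_le_of_le (isCoboundedUnder_le_of_le atTop (x := 0) hge)
    (Eventually.of_forall hle)) ?_
  refine le_of_forall_pos_le_add fun η hη => ?_
  rw [← sub_le_iff_le_add]
  refine le_limsup_of_frequently_le (frequently_atTop.2 fun N => ?_) hbdd
  obtain ⟨K, hK⟩ := exists_nat_gt (1 / η)
  obtain ⟨k, hk, hA⟩ := frequently_atTop.1 h (max N K)
  have hkN : N ≤ k := (le_max_left _ _).trans hk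
  have hkK : K ≤ k := (le_max_right _ _).trans hk
  have hLk := hL k
  refine ⟨M k + L k, by nlinarith, ?_⟩
  have hcard : L k ≤ Set.ncard {i : ℕ | i < M k + L k ∧ A i} := by
    have hsub : (fun i => M k + i) '' Set.Iio (L k) ⊆ {i : ℕ | i < M k + L k ∧ A i} := by
      rintro _ ⟨i, hi, rfl⟩
      exact ⟨Nat.add_lt_add_left hi _, hA i hi⟩
    have := Set.ncard_le_ncard hsub (hfin _)
    rwa [Set.ncard_image_of_injective _ (add_right_injective _), Set.ncard_Iio_nat] at this
  have hcard' : (L k : ℝ) ≤ Set.ncard {i : ℕ | i < M k + L k ∧ A i} := by exact_mod_cast hcard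
  have hLk' : ((k : ℝ) + 1) * (M k + 1) ≤ L k := by exact_mod_cast hLk
  have hkη : 1 < η * (k + 1) := by
    have h1 : 1 / η < k + 1 := by
      have : (K : ℝ) ≤ k := by exact_mod_cast hkK
      linarith
    rwa [div_lt_iff₀ hη, mul_comm] at h1
  have hM0 : (0 : ℝ) ≤ M k := Nat.cast_nonneg _
  have hL0 : (0 : ℝ) < L k := lt_of_lt_of_le (by positivity) hLk'
  push_cast
  rw [le_div_iff₀ (by positivity)]
  refine le_trans ?_ hcard'
  have h2 : (M k : ℝ) ≤ η * L k := by
    calc (M k : ℝ) ≤ η * (k + 1) * (M k + 1) := by nlinarith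
      _ = η * ((k + 1) * (M k + 1)) := by ring
      _ ≤ η * L k := by gcongr
  have h3 : 0 ≤ η * M k := by positivity
  nlinarith

/-- For a recurrent pair linked at every scale, there are orbits which follow, along a fixed
schedule of very long time windows, either of the two points as prescribed. -/
theorem exists_scheduled_orbits (h : HasLimitShadowing f) {q : Bool → X}
    (hpair : ChainPair f (q true) (q false))
    (hrec : ∀ η : ℝ, 0 < η → ∃ T : ℕ, 0 < T ∧ ∀ b, dist (f^[T] (q b)) (q b) < η) :
    ∃ M L T : ℕ → ℕ, StrictMono M ∧ (∀ k, (k + 1) * (M k + 1) ≤ L k) ∧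
      ∀ u : ℕ → Bool, ∃ p : X, ∀ ε : ℝ, 0 < ε → ∀ᶠ k in atTop, ∀ i < L k,
        dist (f^[M k + i] p) (f^[i % T k] (q (u k))) < ε := by
  let η : ℕ → ℝ := fun k => 1 / ((k : ℝ) + 1)
  have hη : ∀ k, 0 < η k := fun k => by positivity
  have hlink : ∀ k, ∃ n : ℕ, 0 < n ∧ ∀ a b, HasChain f (η k) n (q a) (q b) := by
    intro k
    obtain ⟨n, hn, h1, h2, h3, h4⟩ := hpair (η k) (hη k)
    refine ⟨n, hn, ?_⟩
    rintro (_ | _) (_ | _)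
    exacts [h4, h3, h2, h1]
  choose n hn G hG0 hGn hGs using hlink
  have hrec' : ∀ k, _ := fun k => hrec (η k) (hη k)
  choose T hT hTd using hrec'
  -- Each stage is a window of length `L k` followed by a chain of length `n k`; neither depends on
  -- `u`. As `T k` divides `L k`, the window closes up at `q (u k)`, where the chain starts.
  let M : ℕ → ℕ := fun k => Nat.rec 0 (fun k m => m + (T k * ((k + 1) * (m + 1)) + n k)) k
  let L : ℕ → ℕ := fun k => T k * ((k + 1) * (M k + 1))
  have hMs : ∀ k, M (k + 1) = M k + (L k + n k) := fun k => rfl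
  have hM : StrictMono M := strictMono_nat_of_lt_succ fun k => by
    have := hn k
    rw [hMs]
    omega
  have hLpos : ∀ k, 0 < L k := fun k => Nat.mul_pos (hT k) (by positivity)
  refine ⟨M, L, T, hM, fun k => Nat.le_mul_of_pos_left _ (hT k), fun u => ?_⟩
  let B : ℕ → ℕ → X := fun k i =>
    if i < L k then f^[i % T k] (q (u k)) else G k (u k) (u (k + 1)) (i - L k)
  have hBle : ∀ k i, i ≤ L k → B k i = f^[i % T k] (q (u k)) := by
    intro k i hi
    rcases hi.lt_or_eq with h | rfl
    · simp [B, h]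
    · simp [B, L, hG0]
  have hBge : ∀ k i, L k ≤ i → B k i = G k (u k) (u (k + 1)) (i - L k) := by
    intro k i hi
    simp [B, not_lt.2 hi]
  obtain ⟨ξ, hξ, hξB⟩ := exists_isLimitPseudoOrbit_of_blocks (f := f) (M := M) rfl hM B
    (tendsto_one_div_add_atTop_nhds_zero_nat (𝕜 := ℝ))
    (fun k i hi => by
      rw [hMs] at hi
      by_cases hiL : i < L k
      · rw [hBle k i hiL.le, hBle k (i + 1) hiL]
        have hlt := Nat.mod_lt i (hT k)
        by_cases hj : i % T k + 1 < T k
        · have h1 : (i + 1) % T k = i % T k + 1 := by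
            rw [Nat.add_mod, Nat.mod_eq_of_lt (a := 1) (by omega), Nat.mod_eq_of_lt hj]
          rw [h1, Function.iterate_succ_apply', dist_self]
          exact (hη k).le
        · have h0 : i % T k + 1 = T k := by omega
          have h1 : (i + 1) % T k = 0 := by
            rw [← Nat.mod_add_mod, h0, Nat.mod_self]
          rw [h1, ← Function.iterate_succ_apply' f, Nat.succ_eq_add_one, h0]
          exact (hTd k _).le
      · rw [hBge k i (by omega), hBge k (i + 1) (by omega),
          show i + 1 - L k = i - L k + 1 by omega]
        exact (hGs k _ _ _ (by omega)).le)
    (fun k => by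
      rw [hMs, Nat.add_sub_cancel_left, hBge k _ (Nat.le_add_right _ _),
        Nat.add_sub_cancel_left, hGn, hBle (k + 1) 0 (Nat.zero_le _), Nat.zero_mod,
        Function.iterate_zero, id, dist_self]
      positivity)
  obtain ⟨p, hp⟩ := h ξ hξ
  refine ⟨p, fun ε hε => ?_⟩
  obtain ⟨N, hN⟩ := Metric.tendsto_atTop.1 hp ε hε
  filter_upwards [hM.tendsto_atTop.eventually_ge_atTop N] with k hk i hi
  have h1 := hN (M k + i) (by omega)
  rwa [Real.dist_0_eq_abs, abs_of_nonneg dist_nonneg, hξB k i (by rw [hMs]; omega),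
    hBle k i hi.le] at h1

/-- In late windows where the words agree, both orbits follow the same point; where they differ, the
distance exceeds `c - c / 3 - c / 3`. Shifting by `m` only brings windows forward, and shifted pairs
are what the closure statement needs. -/
theorem isDC1Pair_iterate_of_scheduled {q : Bool → X} {c : ℝ} (hc : 0 < c)
    (hdist : ∀ i, c ≤ dist (f^[i] (q true)) (f^[i] (q false))) {M L T : ℕ → ℕ}
    (hM : StrictMono M) (hL : ∀ k, (k + 1) * (M k + 1) ≤ L k) {u u' : ℕ → Bool} {p p' : X}
    (hp : ∀ ε : ℝ, 0 < ε → ∀ᶠ k in atTop, ∀ i < L k,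
      dist (f^[M k + i] p) (f^[i % T k] (q (u k))) < ε)
    (hp' : ∀ ε : ℝ, 0 < ε → ∀ᶠ k in atTop, ∀ i < L k,
      dist (f^[M k + i] p') (f^[i % T k] (q (u' k))) < ε)
    (heq : ∃ᶠ k in atTop, u k = u' k) (hne : ∃ᶠ k in atTop, u k ≠ u' k) (m : ℕ) :
    IsDC1Pair f (f^[m] p) (f^[m] p') := by
  have hL' : ∀ k, (k + 1) * ((M k - m) + 1) ≤ L k := fun k =>
    (Nat.mul_le_mul_left _ (by omega)).trans (hL k)
  have hMm := hM.tendsto_atTop.eventually_ge_atTop m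
  refine ⟨fun δ hδ => ?_, c / 3, by positivity, ?_⟩
  · refine limsup_density_eq_one (M := fun k => M k - m) hL' ?_
    refine (heq.and_eventually (hMm.and ((hp (δ / 2) (by positivity)).and
      (hp' (δ / 2) (by positivity))))).mono ?_
    rintro k ⟨hk, hmk, h1, h2⟩ i hi
    have h1 := h1 i hi
    have h2 := h2 i hi
    rw [← Function.iterate_add_apply, ← Function.iterate_add_apply,
      show M k - m + i + m = M k + i by omega]
    rw [← hk] at h2
    have := dist_triangle_right (f^[M k + i] p) (f^[M k + i] p') (f^[i % T k] (q (u k)))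
    linarith
  · refine limsup_density_eq_one (M := fun k => M k - m) hL' ?_
    refine (hne.and_eventually (hMm.and ((hp (c / 3) (by positivity)).and
      (hp' (c / 3) (by positivity))))).mono ?_
    rintro k ⟨hk, hmk, h1, h2⟩ i hi
    have h1 := h1 i hi
    have h2 := h2 i hi
    rw [← Function.iterate_add_apply, ← Function.iterate_add_apply,
      show M k - m + i + m = M k + i by omega]
    have h3 : c ≤ dist (f^[i % T k] (q (u k))) (f^[i % T k] (q (u' k))) := by
      have := hdist (i % T k)
      have hcomm := dist_comm (f^[i % T k] (q true)) (f^[i % T k] (q false))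
      cases hu : u k <;> cases hu' : u' k <;> simp_all
    have h4 := dist_triangle4 (f^[i % T k] (q (u k))) (f^[M k + i] p) (f^[M k + i] p')
      (f^[i % T k] (q (u' k)))
    rw [dist_comm] at h1
    linarith

theorem IsDC1Pair.ne {x y : X} (h : IsDC1Pair f x y) : x ≠ y := by
  rintro rfl
  obtain ⟨δ₀, hδ₀, hlim⟩ := h.2
  simp [hδ₀.le.not_gt] at hlim

/-! ### An uncountable scrambled set and approximation of chain pairs. -/

/-- A word in which every symbol of `s` occurs infinitely often, and so does `true`. -/
def recurringWord (s : ℕ → Bool) (k : ℕ) : Bool :=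
  if k.unpair.1 = 0 then true else s (k.unpair.1 - 1)

theorem frequently_unpair_fst_eq (a : ℕ) : ∃ᶠ k : ℕ in atTop, k.unpair.1 = a :=
  frequently_atTop.2 fun N => ⟨Nat.pair a N, Nat.right_le_pair a N, by simp⟩

theorem frequently_recurringWord_eq (s t : ℕ → Bool) :
    ∃ᶠ k in atTop, recurringWord s k = recurringWord t k :=
  (frequently_unpair_fst_eq 0).mono fun k hk => by simp [recurringWord, hk]

theorem frequently_recurringWord (s t : ℕ → Bool) (a : ℕ) :
    ∃ᶠ k in atTop, recurringWord s k = s a ∧ recurringWord t k = t a :=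
  (frequently_unpair_fst_eq (a + 1)).mono fun k hk => by simp [recurringWord, hk]

theorem exhibitsDC1_and_near_of_chainPair [CompactSpace X] (hf : Continuous f)
    (h : HasLimitShadowing f) {x y : X} (hxy : ChainPair f x y) (hne : x ≠ y) :
    ExhibitsDC1 f ∧ (x, y) ∈ closure (DC1Pairs f) := by
  have key : ∀ ε : ℝ, 0 < ε → ExhibitsDC1 f ∧ ∃ p ∈ DC1Pairs f, dist (x, y) p < ε := by
    intro ε hε
    obtain ⟨z, w, hpair, hzx, hwy, ⟨c, hc, hdist⟩, hrec⟩ :=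
      exists_recurrent_distal_chainPair hf h hxy hne (half_pos hε)
    let q : Bool → X := fun b => if b then z else w
    obtain ⟨M, L, T, hM, hL, horb⟩ := exists_scheduled_orbits h (q := q) hpair fun η hη => by
      obtain ⟨T, hT, h1, h2⟩ := hrec η hη
      exact ⟨T, hT, fun b => by cases b <;> assumption⟩
    have horb' : ∀ s : ℕ → Bool, _ := fun s => horb (recurringWord s)
    choose P hP using horb'
    have hDC : ∀ s t, s ≠ t → ∀ m, IsDC1Pair f (f^[m] (P s)) (f^[m] (P t)) := by
      intro s t hst m
      obtain ⟨a, ha⟩ := Function.ne_iff.1 hst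
      refine isDC1Pair_iterate_of_scheduled (q := q) hc hdist hM hL (hP s) (hP t)
        (frequently_recurringWord_eq s t) ?_ m
      exact (frequently_recurringWord s t a).mono fun k hk => by rwa [hk.1, hk.2]
    constructor
    · refine ⟨Set.range P, fun hcount => ?_, ?_⟩
      · have hinj : Function.Injective P := fun s t hst => by
          by_contra hne
          exact (hDC s t hne 0).ne hst
        have h1 : Countable (ℕ → Bool) := by
          have := hcount.to_subtype
          exact (Equiv.ofInjective P hinj).countable_iff.2 this
        classical
        obtain ⟨e, he⟩ := exists_injective_nat (ℕ → Bool)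
        refine Function.cantor_injective (fun S : Set ℕ => e fun n => decide (n ∈ S)) ?_
        intro S S' hS
        ext n
        simpa using congrFun (he hS) n
      · rintro _ ⟨s, rfl⟩ _ ⟨t, rfl⟩ hne
        exact hDC s t (fun hst => hne (by rw [hst])) 0
    -- At the start of a late window prescribing `z` to one orbit and `w` to the other, the shifted
    -- pair is close to `(z, w)`, hence to `(x, y)`, and it is still a DC1-pair.
    · have hst : (fun _ : ℕ => true) ≠ fun _ => false := fun h => by simpa using congrFun h 0
      obtain ⟨k, ⟨hs, ht⟩, h1, h2⟩ := ((frequently_recurringWord (fun _ => true)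
        (fun _ => false) 0).and_eventually ((hP _ (ε / 2) (half_pos hε)).and
          (hP _ (ε / 2) (half_pos hε)))).exists
      refine ⟨(f^[M k] (P fun _ => true), f^[M k] (P fun _ => false)), hDC _ _ hst (M k), ?_⟩
      have hLpos : 0 < L k := lt_of_lt_of_le (by positivity) (hL k)
      have h1 := h1 0 hLpos
      have h2 := h2 0 hLpos
      rw [hs] at h1
      rw [ht] at h2
      simp only [add_zero, Nat.zero_mod, Function.iterate_zero, id, q, if_true] at h1
      simp only [add_zero, Nat.zero_mod, Function.iterate_zero, id, q] at h2
      rw [Prod.dist_eq, max_lt_iff]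
      rw [dist_comm] at hzx hwy h1 h2
      exact ⟨(dist_triangle x z _).trans_lt (by linarith),
        (dist_triangle y w _).trans_lt (by simp at h2; linarith)⟩
  exact ⟨(key 1 one_pos).1, Metric.mem_closure_iff.2 fun ε hε => (key ε hε).2⟩

end LimitShadowingDC1

end

theorem theorem1p2 {X : Type*} [MetricSpace X] [CompactSpace X] (f : X → X) (hf : Continuous f)
    (hshadow : LimitShadowingDC1.HasLimitShadowing f)
    (hent : 0 < LimitShadowingDC1.topEntropy f) :
    LimitShadowingDC1.ExhibitsDC1 f ∧
      LimitShadowingDC1.entropyPairs f ⊆ closure (LimitShadowingDC1.DC1Pairs f) := by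
  obtain ⟨x, y, hne, hxy⟩ := LimitShadowingDC1.exists_chainPair_of_topEntropy_pos hf hent
  refine ⟨(LimitShadowingDC1.exhibitsDC1_and_near_of_chainPair hf hshadow hxy hne).1, ?_⟩
  rintro ⟨a, b⟩ hab
  exact (LimitShadowingDC1.exhibitsDC1_and_near_of_chainPair hf hshadow
    (LimitShadowingDC1.IsEntropyPair.chainPair hf hab) hab.1).2
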